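/- Let $D$ be a Dedekind domain, and for $a\in D$ put $T(a)=\begin{pmatrix}1&a\\0&1\end{pmatrix}\in SL_2(D)$. Let $H$ be a congruence subgroup of $SL_2(D)$, that is, a subgroup that contains $SL_2(D,\mathfrak q')=\{X\in SL_2(D): X\equiv I_2 \pmod{\mathfrak q'}\}$ for some ideal $\mathfrak q'\neq\{0\}$ of $D$. Let the level $l(H)$ be the largest ideal $\mathfrak a$ of $D$ such that $H$ contains the normal subgroup of $SL_2(D)$ generated by all $T(a)$ with $a\in\mathfrak a$, and let the quasi-level be $$ql(H)=\{a\in D:\ gT(a)g^{-1}\in H \text{ for all } g\in SL_2(D)\}.$$ Suppose that the ideal $\mathfrak q=l(H)$ satisfies Condition L: $\mathfrak q\neq\{0\}$, $\mathfrak q+(2)=D$, and there is no prime ideal $\mathfrak p$ of $D$ with $|D/\mathfrak p|=3$ and $\mathrm{ord}_{\mathfrak p}(\mathfrak q)=1$. Then $$ql(H)=l(H);$$ in particular, the quasi-level $ql(H)$ is an ideal of $D$. -/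

import Mathlib

open scoped MatrixGroups

namespace SLTwo

variable {R : Type*} [CommRing R]

/-- The translation matrix `T(r)` with rows `(1, r)` and `(0, 1)`. -/
def T (r : R) : SL(2, R) :=
  ⟨!![1, r; 0, 1], by simp [Matrix.det_fin_two]⟩

theorem T_zero : T (0 : R) = 1 := by
  ext i j
  fin_cases i <;> fin_cases j <;> simp [T]

theorem T_add (a b : R) : T (a + b) = T a * T b := by
  apply Subtype.ext
  rw [Matrix.SpecialLinearGroup.coe_mul]
  simp [T, add_comm]

/-- The principal congruence subgroup `SL₂(R, q)`: the matrices congruent to the identity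
modulo the ideal `q`. -/
def principalCongruence (q : Ideal R) : Subgroup SL(2, R) :=
  (Matrix.SpecialLinearGroup.map (n := Fin 2) (Ideal.Quotient.mk q)).ker

/-- `H` is a congruence subgroup if it contains `SL₂(R, q)` for some non-zero ideal `q`. -/
def IsCongruenceSubgroup (H : Subgroup SL(2, R)) : Prop :=
  ∃ q : Ideal R, q ≠ ⊥ ∧ principalCongruence q ≤ H

/-- `NE₂(R, q)`: the normal subgroup of `SL₂(R)` generated by all `T(r)` with `r ∈ q`. -/
def NE (q : Ideal R) : Subgroup SL(2, R) :=
  Subgroup.normalClosure (T '' (q : Set R))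

/-- The level of `H`: the largest ideal `q` with `NE₂(R, q) ≤ H`
(see `isGreatest_level` for the fact that the supremum is attained). -/
def level (H : Subgroup SL(2, R)) : Ideal R :=
  sSup {q : Ideal R | NE q ≤ H}

theorem NE_le_iff (q : Ideal R) (H : Subgroup SL(2, R)) :
    NE q ≤ H ↔ ∀ a ∈ q, T a ∈ H.normalCore := by
  unfold NE
  rw [← Subgroup.normal_le_normalCore, ← Subgroup.normalClosure_subset_iff, Set.image_subset_iff]
  rfl

theorem isGreatest_level (H : Subgroup SL(2, R)) :
    IsGreatest {q : Ideal R | NE q ≤ H} (level H) := by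
  refine ⟨?_, fun q hq => le_sSup hq⟩
  rw [Set.mem_ofPred_eq, NE_le_iff]
  intro a ha
  unfold level at ha
  rw [sSup_eq_iSup'] at ha
  refine Submodule.iSup_induction _ (motive := fun x => T x ∈ H.normalCore) ha ?_ ?_ ?_
  · exact fun q x hx => (NE_le_iff q.1 H).1 q.2 x hx
  · rw [T_zero]
    exact one_mem _
  · intro x y hx hy
    rw [T_add]
    exact mul_mem hx hy

/-- The quasi-amplitude `b(H, g) = {b : g T(b) g⁻¹ ∈ H} = {b : T(b) ∈ g⁻¹ H g}`. -/
def quasiAmplitude (H : Subgroup SL(2, R)) (g : SL(2, R)) : Set R :=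
  {b : R | g * T b * g⁻¹ ∈ H}

/-- The quasi-level of `H`: all `a` such that `T(a)` lies in every conjugate of `H`. -/
def quasiLevel (H : Subgroup SL(2, R)) : Set R :=
  ⋂ g : SL(2, R), quasiAmplitude H g

/-- Condition L for an ideal `q`: it is non-zero, prime to `2`, and no prime ideal `p` with
`|R/p| = 3` divides `q` exactly once (`emultiplicity p q` is `ord_p(q)`). -/
def ConditionL (q : Ideal R) : Prop :=
  q ≠ ⊥ ∧ q ⊔ Ideal.span {2} = ⊤ ∧
    ∀ p : Ideal R, p.IsPrime → Nat.card (R ⧸ p) = 3 → emultiplicity p q ≠ 1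

end SLTwo

/-! Let `N` be the normal core of `H` and `q` its level. Over a semilocal ring principal congruence
subgroups are generated by elementary conjugates of translations, so `N` contains `SL₂(D, q)` and
everything can be tested over `D ⧸ q`, where 2 is a unit. There, maximality of `q` says that `b = 0`
once every `T (r * b)` lies in the image of `N`. Let `T a` lie in that image. Conjugation by
diagonal matrices multiplies `a` by squares of units. Differences of such squares fill the Jacobson
radical `J`, so `J * a = 0`. At a maximal ideal `P` whose residue field does not have 3 elements
they also reach beyond `P`, so `a ∈ P`. If the residue field has 3 elements, Condition L gives `q ≤
p ^ 2` for the preimage `p` of `P`, and `J * a = 0` forces `a ∈ P`. Hence `a ∈ J` and `a ^ 2 = 0`; a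
matrix computation then yields all `T (4 * (x * a))`, so `a = 0`. -/

namespace SLTwo

/-! ### Elementary matrices and generation of congruence subgroups -/

section Ring

variable {R : Type*} [CommRing R]

/-- The lower translation matrix with rows `(1, 0)` and `(r, 1)`. -/
def lowerT (r : R) : SL(2, R) :=
  ⟨!![1, 0; r, 1], by simp [Matrix.det_fin_two]⟩

/-- The diagonal matrix with entries `u` and `u⁻¹`. -/
def diagonalUnit (u : Rˣ) : SL(2, R) :=
  ⟨!![(u : R), 0; 0, ((u⁻¹ : Rˣ) : R)], by simp [Matrix.det_fin_two]⟩

/-- The matrix of `SL₂(R)` with rows `(a, b)` and `(c, d)`. -/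
def ofEntries (a b c d : R) (h : a * d - b * c = 1) : SL(2, R) :=
  ⟨!![a, b; c, d], by rw [Matrix.det_fin_two_of, h]⟩

theorem SL_ext {g h : SL(2, R)} (h00 : g 0 0 = h 0 0) (h01 : g 0 1 = h 0 1)
    (h10 : g 1 0 = h 1 0) (h11 : g 1 1 = h 1 1) : g = h := by
  ext i j
  fin_cases i <;> fin_cases j <;> assumption

@[simp] theorem mul_apply_two (g h : SL(2, R)) (i j : Fin 2) :
    (g * h) i j = g i 0 * h 0 j + g i 1 * h 1 j := by
  simp [Matrix.SpecialLinearGroup.coe_mul, Matrix.mul_apply, Fin.sum_univ_two]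

@[simp] theorem T_zero_zero (r : R) : T r 0 0 = 1 := rfl
@[simp] theorem T_zero_one (r : R) : T r 0 1 = r := rfl
@[simp] theorem T_one_zero (r : R) : T r 1 0 = 0 := rfl
@[simp] theorem T_one_one (r : R) : T r 1 1 = 1 := rfl
@[simp] theorem lowerT_zero_zero (r : R) : lowerT r 0 0 = 1 := rfl
@[simp] theorem lowerT_zero_one (r : R) : lowerT r 0 1 = 0 := rfl
@[simp] theorem lowerT_one_zero (r : R) : lowerT r 1 0 = r := rfl
@[simp] theorem lowerT_one_one (r : R) : lowerT r 1 1 = 1 := rfl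
@[simp] theorem diagonalUnit_zero_zero (u : Rˣ) : diagonalUnit u 0 0 = u := rfl
@[simp] theorem diagonalUnit_zero_one (u : Rˣ) : diagonalUnit u 0 1 = 0 := rfl
@[simp] theorem diagonalUnit_one_zero (u : Rˣ) : diagonalUnit u 1 0 = 0 := rfl
@[simp] theorem diagonalUnit_one_one (u : Rˣ) : diagonalUnit u 1 1 = ((u⁻¹ : Rˣ) : R) := rfl
@[simp] theorem ofEntries_zero_zero (a b c d : R) (h : a * d - b * c = 1) :
    ofEntries a b c d h 0 0 = a := rfl
@[simp] theorem ofEntries_zero_one (a b c d : R) (h : a * d - b * c = 1) :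
    ofEntries a b c d h 0 1 = b := rfl
@[simp] theorem ofEntries_one_zero (a b c d : R) (h : a * d - b * c = 1) :
    ofEntries a b c d h 1 0 = c := rfl
@[simp] theorem ofEntries_one_one (a b c d : R) (h : a * d - b * c = 1) :
    ofEntries a b c d h 1 1 = d := rfl

theorem T_neg (r : R) : T (-r) = (T r)⁻¹ := by
  rw [eq_inv_iff_mul_eq_one, ← T_add, neg_add_cancel, T_zero]

theorem T_sub_mem {N : Subgroup SL(2, R)} {a b : R} (ha : T a ∈ N) (hb : T b ∈ N) :
    T (a - b) ∈ N := by
  rw [sub_eq_add_neg, T_add, T_neg]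
  exact mul_mem ha (inv_mem hb)

/-- A product of two monomial matrices, with antidiagonals `(u, -u⁻¹)` and `(-1, 1)`. -/
theorem diagonalUnit_eq (u : Rˣ) :
    diagonalUnit u = T (u : R) * lowerT (-((u⁻¹ : Rˣ) : R)) * T (u : R) *
      (T (-1) * lowerT 1 * T (-1)) := by
  apply SL_ext <;> simp

/-- Matrices of `SL₂` whose upper left entry is a unit. -/
theorem eq_lowerT_mul_diagonalUnit_mul_T (g : SL(2, R)) (u : Rˣ) (hu : g 0 0 = u) :
    g = lowerT (g 1 0 * ((u⁻¹ : Rˣ) : R)) * diagonalUnit u * T (((u⁻¹ : Rˣ) : R) * g 0 1) := by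
  have hdet := g.det_coe
  rw [Matrix.det_fin_two, hu] at hdet
  have hui : (u : R) * ((u⁻¹ : Rˣ) : R) = 1 := u.mul_inv
  apply SL_ext <;> simp [hu]
  linear_combination ((u⁻¹ : Rˣ) : R) * hdet - g 1 1 * hui

/-- `N` is normalized by the elementary subgroup of `SL₂(R)`. -/
structure IsElementaryNormal (N : Subgroup SL(2, R)) : Prop where
  T_mem : ∀ x, T x ∈ Subgroup.normalizer (N : Set SL(2, R))
  lowerT_mem : ∀ x, lowerT x ∈ Subgroup.normalizer (N : Set SL(2, R))

theorem mem_of_mul_eq_mul {N : Subgroup SL(2, R)} {g m n : SL(2, R)}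
    (hg : g ∈ Subgroup.normalizer (N : Set SL(2, R))) (hn : n ∈ N) (h : g * n = m * g) :
    m ∈ N := by
  rw [eq_mul_inv_iff_mul_eq.2 h.symm]
  exact (Subgroup.mem_normalizer_iff.1 hg n).1 hn

namespace IsElementaryNormal

variable {N : Subgroup SL(2, R)}

theorem diagonalUnit_mem_normalizer (hN : IsElementaryNormal N) (u : Rˣ) :
    diagonalUnit u ∈ Subgroup.normalizer (N : Set SL(2, R)) := by
  rw [diagonalUnit_eq]
  have h1 := hN.T_mem
  have h2 := hN.lowerT_mem
  exact mul_mem (mul_mem (mul_mem (h1 _) (h2 _)) (h1 _)) (mul_mem (mul_mem (h1 _) (h2 _)) (h1 _))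

theorem T_sq_mul_mem (hN : IsElementaryNormal N) {u : R} (hu : IsUnit u) {a : R} (ha : T a ∈ N) :
    T (u ^ 2 * a) ∈ N := by
  obtain ⟨u, rfl⟩ := hu
  refine mem_of_mul_eq_mul (hN.diagonalUnit_mem_normalizer u) ha ?_
  have hui : (u : R) * ((u⁻¹ : Rˣ) : R) = 1 := u.mul_inv
  apply SL_ext <;> simp
  linear_combination -(u : R) * a * hui

theorem lowerT_mem_of_T_neg_mem (hN : IsElementaryNormal N) {a : R} (ha : T (-a) ∈ N) :
    lowerT a ∈ N := by
  have h1 := hN.T_mem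
  have h2 := hN.lowerT_mem
  refine mem_of_mul_eq_mul (mul_mem (mul_mem (h1 1) (h2 (-1))) (h1 1)) ha ?_
  apply SL_ext <;> simp

/-- If `T a` lies in `N` and `a ^ 2 = 0`, then `N` contains all `T (x * a)`, up to a factor `4`. -/
theorem T_four_mul_mem_of_sq_eq_zero (hN : IsElementaryNormal N) {a : R} (ha : T a ∈ N)
    (ha2 : a ^ 2 = 0) (x : R) : T (4 * (x * a)) ∈ N := by
  -- Conjugate `T a` by `lowerT y`, then cancel `T a` on the right.
  have key (y : R) : ofEntries (1 - a * y) 0 (-(a * y ^ 2)) (1 + a * y)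
      (by linear_combination -y ^ 2 * ha2) ∈ N := by
    have h1 : ofEntries (1 - a * y) a (-(a * y ^ 2)) (1 + a * y) (by ring) ∈ N := by
      refine mem_of_mul_eq_mul (hN.lowerT_mem y) ha ?_
      apply SL_ext <;> simp <;> ring
    rw [← mul_mem_cancel_right ha]
    convert h1 using 1
    apply SL_ext <;> simp
    · linear_combination -y * ha2
    · linear_combination y ^ 2 * ha2
  -- The lower left entry of `key` is even in `y`, so comparing `x` with `-x` leaves a diagonal
  -- matrix; its commutator with `T 1` is the required translation.
  have hd : ofEntries (1 - 2 * (a * x)) 0 0 (1 + 2 * (a * x))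
      (by linear_combination -4 * x ^ 2 * ha2) ∈ N := by
    rw [← mul_mem_cancel_right (key (-x))]
    convert key x using 1
    apply SL_ext <;> simp
    · linear_combination -2 * x ^ 2 * ha2
    · linear_combination 2 * x ^ 3 * ha2
    · linear_combination -2 * x ^ 2 * ha2
  rw [← mul_mem_cancel_right hd]
  refine mem_of_mul_eq_mul (hN.T_mem 1) hd ?_
  apply SL_ext <;> simp
  linear_combination -8 * x ^ 2 * ha2

end IsElementaryNormal

theorem mem_principalCongruence_iff {Q : Ideal R} {g : SL(2, R)} :
    g ∈ principalCongruence Q ↔ g 0 0 - 1 ∈ Q ∧ g 0 1 ∈ Q ∧ g 1 0 ∈ Q ∧ g 1 1 - 1 ∈ Q := by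
  simp only [principalCongruence, MonoidHom.mem_ker, ← Ideal.Quotient.eq_zero_iff_mem, map_sub,
    map_one, sub_eq_zero]
  constructor
  · intro h
    have h' (i j) := congrArg (fun m : SL(2, R ⧸ Q) => m i j) h
    exact ⟨by simpa using h' 0 0, by simpa using h' 0 1, by simpa using h' 1 0,
      by simpa using h' 1 1⟩
  · rintro ⟨h1, h2, h3, h4⟩
    apply SL_ext <;> simpa

theorem isUnit_of_forall_maximal {x : R} (h : ∀ p : Ideal R, p.IsMaximal → x ∉ p) : IsUnit x := by
  by_contra hx
  obtain ⟨p, hp, hxp⟩ := exists_max_ideal_of_mem_nonunits hx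
  exact h p hp hxp

theorem notMem_of_isUnit {x : R} (h : IsUnit x) {p : Ideal R} (hp : p.IsMaximal) : x ∉ p :=
  fun hx => hp.ne_top (p.eq_top_of_isUnit_mem hx h)

/-- The Chinese remainder theorem for the maximal ideals of a semilocal ring. -/
theorem exists_sub_mem_maximal [Finite (MaximalSpectrum R)] (f : Ideal R → R) :
    ∃ x, ∀ p : Ideal R, p.IsMaximal → x - f p ∈ p := by
  obtain ⟨x, hx⟩ := Ideal.exists_forall_sub_mem_ideal (I := fun p : MaximalSpectrum R => p.asIdeal)
    (fun p q hpq => by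
      rw [Function.onFun, Ideal.isCoprime_iff_sup_eq]
      exact p.2.coprime_of_ne q.2 fun h => hpq (MaximalSpectrum.ext h)) (fun p => f p.asIdeal)
  exact ⟨x, fun p hp => hx ⟨p, hp⟩⟩

/-- Over a semilocal ring, `SL₂(R, Q)` is generated by elementary conjugates of the
translations `T b` with `b ∈ Q`. -/
theorem IsElementaryNormal.principalCongruence_le [Finite (MaximalSpectrum R)]
    {N : Subgroup SL(2, R)} (hN : IsElementaryNormal N) {Q : Ideal R} (hQ : ∀ b ∈ Q, T b ∈ N) :
    principalCongruence Q ≤ N := by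
  have hQ' (b) (hb : b ∈ Q) : lowerT b ∈ N := hN.lowerT_mem_of_T_neg_mem (hQ _ (neg_mem hb))
  have hdiag (u : Rˣ) (hu : (u : R) - 1 ∈ Q) : diagonalUnit u ∈ N := by
    set t := (u : R) - 1 with ht
    -- The conjugate of `lowerT t` by `T 1` has corner `u`; its outer triangular factors lie in `N`,
    -- hence so does the diagonal one.
    have h1 : ofEntries (1 + t) (-t) t (1 - t) (by ring) ∈ N := by
      refine mem_of_mul_eq_mul (hN.T_mem 1) (hQ' t hu) ?_
      apply SL_ext <;> simp
    rw [eq_lowerT_mul_diagonalUnit_mul_T (ofEntries _ _ _ _ _) u (by simp [ht])] at h1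
    rwa [mul_mem_cancel_right (hQ _ (Q.mul_mem_left _ (by simpa using hu))),
      mul_mem_cancel_left (hQ' _ (Q.mul_mem_right _ (by simpa using hu)))] at h1
  have hunit (g : SL(2, R)) (hg : g ∈ principalCongruence Q) (hu : IsUnit (g 0 0)) : g ∈ N := by
    obtain ⟨h1, h2, h3, -⟩ := mem_principalCongruence_iff.1 hg
    obtain ⟨u, hu⟩ := hu
    rw [eq_lowerT_mul_diagonalUnit_mul_T g u hu.symm]
    exact mul_mem (mul_mem (hQ' _ (Q.mul_mem_right _ h3)) (hdiag u (hu ▸ h1)))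
      (hQ _ (Q.mul_mem_left _ h2))
  intro g hg
  obtain ⟨h1, -⟩ := mem_principalCongruence_iff.1 hg
  classical
  -- Left multiplication by `T (x * (1 - g 0 0))` makes the corner a unit: it becomes `g 1 0` modulo
  -- the maximal ideals containing `g 0 0`, and stays `g 0 0` modulo the others.
  obtain ⟨x, hx⟩ := exists_sub_mem_maximal (fun p : Ideal R => if g 0 0 ∈ p then 1 else 0)
  have ht : x * (1 - g 0 0) ∈ Q := Q.mul_mem_left _ (by rw [← neg_sub]; exact neg_mem h1)
  rw [← mul_mem_cancel_left (hQ _ ht)]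
  refine hunit _ (mul_mem (mem_principalCongruence_iff.2 (by simpa using ht)) hg) ?_
  refine isUnit_of_forall_maximal fun p hp hmem => ?_
  have hdet := g.det_coe
  rw [Matrix.det_fin_two] at hdet
  specialize hx p hp
  simp only [mul_apply_two, T_zero_zero, T_zero_one, one_mul] at hmem
  split_ifs at hx with hgp
  · have hc : g 1 0 ∈ p := by
      have : g 1 0 = (g 0 0 + x * (1 - g 0 0) * g 1 0) - (x - 1) * ((1 - g 0 0) * g 1 0)
        - g 0 0 * (1 - g 1 0) := by ring
      rw [this]
      exact sub_mem (sub_mem hmem (p.mul_mem_right _ hx)) (p.mul_mem_right _ hgp)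
    refine hp.ne_top ((Ideal.eq_top_iff_one p).2 ?_)
    rw [← hdet]
    exact sub_mem (p.mul_mem_right _ hgp) (p.mul_mem_left _ hc)
  · apply hgp
    rw [sub_zero] at hx
    have := sub_mem hmem (p.mul_mem_right ((1 - g 0 0) * g 1 0) hx)
    convert this using 1
    ring

end Ring

/-! ### Multipliers of `a` over a semilocal ring with 2 invertible -/

section Semilocal

variable {R : Type*} [CommRing R] {N : Subgroup SL(2, R)}

/-- `N` contains `T (x * a)` whenever it contains `T a` and `x` is in the Jacobson radical. -/
theorem IsElementaryNormal.T_mul_mem_of_mem_maximal (hN : IsElementaryNormal N)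
    (h2 : IsUnit (2 : R)) {a : R} (ha : T a ∈ N) {x : R}
    (hx : ∀ p : Ideal R, p.IsMaximal → x ∈ p) : T (x * a) ∈ N := by
  obtain ⟨c, hc⟩ := h2.exists_right_inv
  have hunit (y : R) : IsUnit (1 + x * y) := isUnit_of_forall_maximal fun p hp h =>
    hp.ne_top ((Ideal.eq_top_iff_one p).2
      ((Ideal.add_mem_iff_left p (p.mul_mem_right y (hx p hp))).1 h))
  -- With `c = 1/2`: `x = (1 + x/4)² - (1 - x/4)²`, a difference of squares of units.
  have := T_sub_mem (hN.T_sq_mul_mem (hunit (c ^ 2)) ha) (hN.T_sq_mul_mem (hunit (-c ^ 2)) ha)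
  convert this using 2
  linear_combination -(x * a) * (2 * c + 1) * hc

/-- Otherwise the residue field would be `{0, 1, -1}`. -/
theorem exists_sq_sub_one_notMem (h2 : IsUnit (2 : R)) {p : Ideal R} (hp : p.IsMaximal)
    (hcard : Nat.card (R ⧸ p) ≠ 3) : ∃ y, y ∉ p ∧ y ^ 2 - 1 ∉ p := by
  by_contra! hall
  apply hcard
  have h2p : (2 : R) ∉ p := notMem_of_isUnit h2 hp
  have h1p : (1 : R) ∉ p := notMem_of_isUnit isUnit_one hp
  let f : Fin 3 → R ⧸ p := ![0, 1, -1]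
  have hinj : Function.Injective f := by
    have h01 : (1 : R ⧸ p) ≠ 0 := fun h => h1p (Ideal.Quotient.eq_zero_iff_mem.1 h)
    have h11 : (1 : R ⧸ p) ≠ -1 := fun h => h2p <| Ideal.Quotient.eq_zero_iff_mem.1 <| by
      rw [← one_add_one_eq_two, map_add, map_one]
      exact eq_neg_iff_add_eq_zero.1 h
    intro i j hij
    fin_cases i <;> fin_cases j <;> simp_all [f, eq_comm]
  have hsurj : Function.Surjective f := by
    intro z
    obtain ⟨y, rfl⟩ := Ideal.Quotient.mk_surjective z
    by_cases hy : y ∈ p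
    · exact ⟨0, (Ideal.Quotient.eq_zero_iff_mem.2 hy).symm⟩
    · have h := hall y hy
      rw [show y ^ 2 - 1 = (y - 1) * (y + 1) by ring] at h
      rcases hp.isPrime.mem_or_mem h with h | h
      · exact ⟨1, by simpa [f] using (Ideal.Quotient.eq.2 h).symm⟩
      · refine ⟨2, ?_⟩
        have := Ideal.Quotient.eq_zero_iff_mem.2 h
        rw [map_add, map_one] at this
        exact (eq_neg_of_add_eq_zero_left this).symm
  rw [← Nat.card_eq_of_bijective f ⟨hinj, hsurj⟩]
  simp

/-- If the residue field of `p` has more than three elements and `T a ∈ N`, then `N` contains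
all `T (r * (c * a))` for some `c` outside `p`. -/
theorem IsElementaryNormal.exists_notMem_forall_T_mem [Finite (MaximalSpectrum R)]
    (hN : IsElementaryNormal N) (h2 : IsUnit (2 : R)) {a : R} (ha : T a ∈ N) {p : Ideal R}
    (hp : p.IsMaximal) (hcard : Nat.card (R ⧸ p) ≠ 3) :
    ∃ c, c ∉ p ∧ ∀ r, T (r * (c * a)) ∈ N := by
  classical
  have hlift (z : R) (hz : z ∉ p) : ∃ u, IsUnit u ∧ u - z ∈ p ∧
      ∀ p' : Ideal R, p'.IsMaximal → p' ≠ p → u - 1 ∈ p' := by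
    obtain ⟨u, hu⟩ := exists_sub_mem_maximal (fun p' : Ideal R => if p' = p then z else 1)
    have hup : u - z ∈ p := by simpa using hu p hp
    have hup' (p' : Ideal R) (hp' : p'.IsMaximal) (hne : p' ≠ p) : u - 1 ∈ p' := by
      simpa [hne] using hu p' hp'
    refine ⟨u, isUnit_of_forall_maximal fun p' hp' hmem => ?_, hup, hup'⟩
    by_cases hne : p' = p
    · subst hne
      exact hz (by simpa using sub_mem hmem hup)
    · exact notMem_of_isUnit isUnit_one hp' (by simpa using sub_mem hmem (hup' p' hp' hne))
  obtain ⟨y, hy, hy1⟩ := exists_sq_sub_one_notMem h2 hp hcard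
  obtain ⟨u, hu, hup, hup'⟩ := hlift y hy
  have hc : u ^ 2 - 1 ∉ p := fun h => hy1 <| by
    have := sub_mem h (p.mul_mem_right (u + y) hup)
    convert this using 1
    ring
  have hc' (p' : Ideal R) (hp' : p'.IsMaximal) (hne : p' ≠ p) : u ^ 2 - 1 ∈ p' := by
    have := p'.mul_mem_right (u + 1) (hup' p' hp' hne)
    convert this using 1
    ring
  generalize hcdef : u ^ 2 - 1 = c at hc hc'
  have hca : T (c * a) ∈ N := by
    rw [← hcdef, sub_mul, one_mul]
    exact T_sub_mem (hN.T_sq_mul_mem hu ha) ha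
  -- Since `c` lies in every other maximal ideal, `z` matters only modulo `p`: it is replaced by a
  -- unit when `z ∉ p`, with an error in the radical.
  have hsq (z : R) : T (z ^ 2 * (c * a)) ∈ N := by
    by_cases hz : z ∈ p
    · rw [← mul_assoc]
      refine hN.T_mul_mem_of_mem_maximal h2 ha fun p' hp' => ?_
      by_cases hne : p' = p
      · subst hne
        exact Ideal.mul_mem_right _ _ (Ideal.pow_mem_of_mem _ hz 2 two_pos)
      · exact Ideal.mul_mem_left _ _ (hc' p' hp' hne)
    · obtain ⟨v, hv, hvp, -⟩ := hlift z hz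
      have h : T (((v ^ 2 - z ^ 2) * c) * a) ∈ N := by
        refine hN.T_mul_mem_of_mem_maximal h2 ha fun p' hp' => ?_
        by_cases hne : p' = p
        · subst hne
          refine Ideal.mul_mem_right _ _ ?_
          rw [show v ^ 2 - z ^ 2 = (v - z) * (v + z) by ring]
          exact Ideal.mul_mem_right _ _ hvp
        · exact Ideal.mul_mem_left _ _ (hc' p' hp' hne)
      have := T_sub_mem (hN.T_sq_mul_mem hv hca) h
      convert this using 2
      ring
  obtain ⟨d, hd⟩ := h2.exists_right_inv
  refine ⟨c, hc, fun r => ?_⟩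
  -- Every `r` is `((r + 1)/2)² - ((r - 1)/2)²`.
  have := T_sub_mem (hsq ((r + 1) * d)) (hsq ((r - 1) * d))
  convert this using 2
  linear_combination -r * (c * a) * (2 * d + 1) * hd

end Semilocal

/-! ### Reduction modulo the level, and the main theorem -/

/-- Elementary matrices lift along `f`, so surjectivity on `SL₂` is not needed. -/
theorem IsElementaryNormal.map {R S : Type*} [CommRing R] [CommRing S] (N : Subgroup SL(2, R))
    [hN : N.Normal] {f : R →+* S} (hf : Function.Surjective f) :
    IsElementaryNormal (N.map (Matrix.SpecialLinearGroup.map (n := Fin 2) f)) := by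
  have key (g : SL(2, R)) : Matrix.SpecialLinearGroup.map (n := Fin 2) f g ∈
      Subgroup.normalizer
        (N.map (Matrix.SpecialLinearGroup.map (n := Fin 2) f) : Set SL(2, S)) := by
    refine Subgroup.le_normalizer_map _ (Subgroup.mem_map_of_mem _ ?_)
    rw [Subgroup.normalizer_eq_top]
    trivial
  constructor <;> intro x <;> obtain ⟨x, rfl⟩ := hf x
  · convert key (T x) using 1
    apply SL_ext <;> simp
  · convert key (lowerT x) using 1
    apply SL_ext <;> simp

theorem map_T {R S : Type*} [CommRing R] [CommRing S] (f : R →+* S) (x : R) :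
    Matrix.SpecialLinearGroup.map (n := Fin 2) f (T x) = T (f x) := by
  apply SL_ext <;> simp

instance principalCongruence_normal {R : Type*} [CommRing R] (q : Ideal R) :
    (principalCongruence q).Normal := by
  unfold principalCongruence
  infer_instance

theorem map_mem_map_iff {R : Type*} [CommRing R] {q : Ideal R} {N : Subgroup SL(2, R)}
    (hq : principalCongruence q ≤ N) {g : SL(2, R)} :
    Matrix.SpecialLinearGroup.map (n := Fin 2) (Ideal.Quotient.mk q) g ∈
      N.map (Matrix.SpecialLinearGroup.map (n := Fin 2) (Ideal.Quotient.mk q)) ↔ g ∈ N := by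
  rw [← Subgroup.mem_comap, Subgroup.comap_map_eq_self hq]

theorem finite_maximalSpectrum_quotient {D : Type*} [CommRing D] [IsDedekindDomain D]
    {q : Ideal D} (hq : q ≠ ⊥) : Finite (MaximalSpectrum (D ⧸ q)) := by
  have : Ring.KrullDimLE 0 (D ⧸ q) := by
    refine Ring.KrullDimLE.mk₀ fun p hp => ?_
    have hne : p.comap (Ideal.Quotient.mk q) ≠ ⊥ := fun h => hq <| by
      rw [eq_bot_iff, ← h]
      intro x hx
      rw [Ideal.mem_comap, Ideal.Quotient.eq_zero_iff_mem.2 hx]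
      exact p.zero_mem
    have hmax := (Ideal.comap_isPrime (Ideal.Quotient.mk q) p).isMaximal hne
    have := Ideal.map_eq_top_or_isMaximal_of_surjective (Ideal.Quotient.mk q)
      Ideal.Quotient.mk_surjective hmax
    rw [Ideal.map_comap_of_surjective _ Ideal.Quotient.mk_surjective] at this
    exact this.resolve_left hp.ne_top
  have : IsArtinianRing (D ⧸ q) :=
    isArtinianRing_iff_isNoetherianRing_krullDimLE_zero.2 ⟨inferInstance, this⟩
  infer_instance

/-- A normal congruence subgroup that contains `NE₂(D, q)` contains `SL₂(D, q)`. -/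
theorem principalCongruence_le_of_forall_T_mem {D : Type*} [CommRing D] [IsDedekindDomain D]
    {N : Subgroup SL(2, D)} [N.Normal] {q' q : Ideal D} (hq' : q' ≠ ⊥)
    (hq'N : principalCongruence q' ≤ N) (hT : ∀ a ∈ q, T a ∈ N) :
    principalCongruence q ≤ N := by
  have := finite_maximalSpectrum_quotient hq'
  intro g hg
  rw [← map_mem_map_iff hq'N]
  refine (IsElementaryNormal.map N Ideal.Quotient.mk_surjective).principalCongruence_le
    (Q := q.map (Ideal.Quotient.mk q')) (fun b hb => ?_) ?_
  · obtain ⟨b, hbq, rfl⟩ := (Ideal.mem_map_iff_of_surjective _ Ideal.Quotient.mk_surjective).1 hb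
    rw [← map_T]
    exact Subgroup.mem_map_of_mem _ (hT b hbq)
  · obtain ⟨h1, h2, h3, h4⟩ := mem_principalCongruence_iff.1 hg
    have := fun x (hx : x ∈ q) => Ideal.mem_map_of_mem (Ideal.Quotient.mk q') hx
    exact mem_principalCongruence_iff.2 ⟨by simpa using this _ h1, by simpa using this _ h2,
      by simpa using this _ h3, by simpa using this _ h4⟩

/-- If `a` is killed modulo `q` by every element of the Jacobson radical of `D ⧸ q` and
`p ^ 2` divides `q`, then `a ∈ p`. -/
theorem mem_of_forall_mul_eq_zero {D : Type*} [CommRing D] [IsDedekindDomain D] {q : Ideal D}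
    (hq : q ≠ ⊥) {P : Ideal (D ⧸ q)} (hP : P.IsMaximal)
    (hsq : q ≤ P.comap (Ideal.Quotient.mk q) ^ 2) {a : D ⧸ q}
    (hJ : ∀ x, (∀ p : Ideal (D ⧸ q), p.IsMaximal → x ∈ p) → x * a = 0) : a ∈ P := by
  classical
  have := finite_maximalSpectrum_quotient hq
  have hprime := Ideal.comap_isPrime (Ideal.Quotient.mk q) P
  set p := P.comap (Ideal.Quotient.mk q) with hp
  have hp0 : p ≠ ⊥ := fun h => hq (eq_bot_iff.2 (hsq.trans (by rw [h]; simp)))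
  by_contra ha
  obtain ⟨a, rfl⟩ := Ideal.Quotient.mk_surjective a
  -- For `y ∈ p`, `e * y` is in the radical, so `e * y * a` vanishes modulo `q`. As `e * a ∉ p`,
  -- this would give `p ≤ p ^ 2`.
  obtain ⟨e, he⟩ := exists_sub_mem_maximal (fun p' : Ideal (D ⧸ q) => if p' = P then 1 else 0)
  obtain ⟨e, rfl⟩ := Ideal.Quotient.mk_surjective e
  have heP : e ∉ p := fun h => notMem_of_isUnit isUnit_one hP <| by
    have := sub_mem (Ideal.mem_comap.1 h) (he P hP)
    simpa using this
  have hle : p ≤ p ^ 2 := fun y hy => by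
    have h0 : Ideal.Quotient.mk q (e * y) * Ideal.Quotient.mk q a = 0 := by
      refine hJ _ fun p' hp' => ?_
      rw [map_mul]
      by_cases hne : p' = P
      · subst hne
        exact Ideal.mul_mem_left _ _ hy
      · exact Ideal.mul_mem_right _ _ (by simpa [hne] using he p' hp')
    rw [← map_mul, Ideal.Quotient.eq_zero_iff_mem] at h0
    have h1 : (e * a) * y ∈ p ^ 2 := by
      rw [show e * a * y = e * y * a by ring]
      exact hsq h0
    exact (Ideal.IsPrime.mul_mem_pow p h1).resolve_left fun h =>
      (hprime.mem_or_mem h).elim heP ha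
  have hlt := Ideal.pow_succ_lt_pow hp0 1
  rw [pow_one] at hlt
  exact absurd hle hlt.not_ge

theorem ConditionL.le_sq {D : Type*} [CommRing D] [IsDedekindDomain D] {q : Ideal D}
    (hL : ConditionL q) {p : Ideal D} (hp : p.IsPrime) (hcard : Nat.card (D ⧸ p) = 3)
    (hle : q ≤ p) : q ≤ p ^ 2 := by
  by_contra h
  refine hL.2.2 p hp hcard ?_
  rw [← Nat.cast_one, emultiplicity_eq_coe, pow_one, Ideal.dvd_iff_le, Ideal.dvd_iff_le]
  exact ⟨hle, h⟩

/-- A congruence subgroup satisfies `ql(H) ⊆ l(H)` if its level satisfies Condition L. -/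
theorem quasiLevel_subset_level {D : Type*} [CommRing D] [IsDedekindDomain D]
    (H : Subgroup SL(2, D)) (hH : IsCongruenceSubgroup H) (hL : ConditionL (level H)) :
    quasiLevel H ⊆ level H := by
  obtain ⟨q', hq', hle⟩ := hH
  have hq := hL.1
  have hlevel : ∀ b ∈ level H, T b ∈ H.normalCore := (NE_le_iff _ _).1 (isGreatest_level H).1
  have hq'N : principalCongruence q' ≤ H.normalCore := Subgroup.normal_le_normalCore.2 hle
  have hqN := principalCongruence_le_of_forall_T_mem hq' hq'N hlevel
  have := finite_maximalSpectrum_quotient hq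
  have hE := IsElementaryNormal.map H.normalCore (Ideal.Quotient.mk_surjective (I := level H))
  have h2 : IsUnit (2 : D ⧸ level H) := by
    obtain ⟨x, hx, y, hy, hxy⟩ := Submodule.mem_sup.1 ((Ideal.eq_top_iff_one _).1 hL.2.1)
    obtain ⟨z, rfl⟩ := Ideal.mem_span_singleton'.1 hy
    refine IsUnit.of_mul_eq_one_right (Ideal.Quotient.mk _ z) ?_
    have := congrArg (Ideal.Quotient.mk (level H)) hxy
    rwa [map_add, Ideal.Quotient.eq_zero_iff_mem.2 hx, zero_add, map_mul, map_ofNat,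
      map_one] at this
  -- Otherwise the span of a lift of `b` would violate the maximality of the level.
  have hzero (b : D ⧸ level H)
      (hb : ∀ r, T (r * b) ∈ H.normalCore.map
        (Matrix.SpecialLinearGroup.map (n := Fin 2) (Ideal.Quotient.mk (level H)))) : b = 0 := by
    obtain ⟨b, rfl⟩ := Ideal.Quotient.mk_surjective b
    rw [Ideal.Quotient.eq_zero_iff_mem, ← Ideal.span_singleton_le_iff_mem]
    refine (isGreatest_level H).2 ((NE_le_iff _ _).2 fun c hc => ?_)
    obtain ⟨r, rfl⟩ := Ideal.mem_span_singleton'.1 hc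
    rw [← map_mem_map_iff hqN, map_T, map_mul]
    exact hb _
  intro a ha
  have haN : T a ∈ H.normalCore := fun g => Set.mem_iInter.1 ha g
  rw [← map_mem_map_iff hqN, map_T] at haN
  rw [SetLike.mem_coe, ← Ideal.Quotient.eq_zero_iff_mem]
  generalize Ideal.Quotient.mk (level H) a = a at haN
  have hJ (x : D ⧸ level H) (hx : ∀ p : Ideal (D ⧸ level H), p.IsMaximal → x ∈ p) :
      x * a = 0 := hzero _ fun r => by
    rw [← mul_assoc]
    exact hE.T_mul_mem_of_mem_maximal h2 haN fun p hp => p.mul_mem_left _ (hx p hp)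
  have hmem (P : Ideal (D ⧸ level H)) (hP : P.IsMaximal) : a ∈ P := by
    by_cases hcard : Nat.card ((D ⧸ level H) ⧸ P) = 3
    · refine mem_of_forall_mul_eq_zero hq hP ?_ hJ
      have hker : level H ≤ P.comap (Ideal.Quotient.mk (level H)) := fun x hx => by
        rw [Ideal.mem_comap, Ideal.Quotient.eq_zero_iff_mem.2 hx]
        exact P.zero_mem
      refine hL.le_sq (Ideal.comap_isPrime _ P) ?_ hker
      rw [← hcard]
      exact Nat.card_eq_of_bijective (Ideal.quotientMap P (Ideal.Quotient.mk (level H)) le_rfl)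
        ⟨Ideal.quotientMap_injective, Ideal.quotientMap_surjective Ideal.Quotient.mk_surjective⟩
    · obtain ⟨c, hc, hr⟩ := hE.exists_notMem_forall_T_mem h2 haN hP hcard
      have h0 : c * a = 0 := hzero _ hr
      exact (hP.isPrime.mem_or_mem (h0 ▸ P.zero_mem : c * a ∈ P)).resolve_left hc
  refine hzero a fun r => ?_
  obtain ⟨d, hd⟩ := h2.exists_right_inv
  -- Here `d = 1/2`, so `d ^ 2` cancels the factor 4.
  have := hE.T_four_mul_mem_of_sq_eq_zero haN (by rw [sq, hJ a hmem]) (r * d ^ 2)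
  convert this using 2
  linear_combination -(r * a) * (2 * d + 1) * hd

end SLTwo

theorem theorem4p6 {D : Type*} [CommRing D] [IsDedekindDomain D]
    (H : Subgroup SL(2, D)) (hH : SLTwo.IsCongruenceSubgroup H)
    (hL : SLTwo.ConditionL (SLTwo.level H)) :
    SLTwo.quasiLevel H = (SLTwo.level H : Set D) ∧
      ∃ I : Ideal D, SLTwo.quasiLevel H = (I : Set D) := by
  have h : SLTwo.quasiLevel H = (SLTwo.level H : Set D) :=
    (SLTwo.quasiLevel_subset_level H hH hL).antisymm fun a ha => Set.mem_iInter.2 fun g =>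
      (SLTwo.NE_le_iff _ _).1 (SLTwo.isGreatest_level H).1 a ha g
  exact ⟨h, _, h⟩
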